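/- Let $n\ge 0$ and let $X\subset\mathbb{C}^{2n}$ be a smooth closed algebraic subset of dimension $n$: the coordinate ring $\mathbb{C}[x_1,\dots,x_{2n}]/I(X)$ has Krull dimension $n$, and at every $x\in X$ the tangent space $$T_xX=\Big\{v\in\mathbb{C}^{2n}:\ \sum_{i}\frac{\partial f}{\partial x_i}(x)\,v_i=0\ \text{ for all } f\in I(X)\Big\},$$ a linear subspace of $\mathbb{C}^{2n}$, has dimension $n$. Suppose that $X$ is in very general position, i.e. that for some $x\in X$ the set $T_xX\cap X$ has an isolated point (in the usual topology); the condition may also be read with the affine tangent space, i.e. it suffices that for some $x\in X$ the set $(x+T_xX)\cap X$ has an isolated point. Then $X$ is in general position, i.e. there exist points $x,y\in X$ such that $T_xX\oplus T_yX=\mathbb{C}^{2n}$. If moreover $X$ is irreducible, then $T_xX\oplus T_yX=\mathbb{C}^{2n}$ holds for a generic pair $(x,y)\in X\times X$, i.e. for all $(x,y)$ in some Zariski open and Zariski dense subset of $X\times X$. -/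

import Mathlib

noncomputable section

/-- A Zariski closed subset of affine space `ℂ^σ`. -/
def IsAlgebraicSet {σ : Type*} (X : Set (σ → ℂ)) : Prop :=
  ∃ I : Ideal (MvPolynomial σ ℂ), X = MvPolynomial.zeroLocus ℂ I

/-- Irreducibility of an algebraic set (in particular it is nonempty): its ideal is prime. -/
def IsIrreducibleSet {σ : Type*} (X : Set (σ → ℂ)) : Prop :=
  (MvPolynomial.vanishingIdeal ℂ X).IsPrime

/-- The tangent space `T_x X`, a linear subspace (through `0`) of `ℂ^σ`: the vectors that are
annihilated by the differentials at `x` of all polynomials of the ideal `I(X)`. -/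
def tangentSpaceAt {σ : Type*} [Fintype σ] (X : Set (σ → ℂ)) (x : σ → ℂ) :
    Submodule ℂ (σ → ℂ) where
  carrier := {v | ∀ f ∈ MvPolynomial.vanishingIdeal ℂ X,
    ∑ i, MvPolynomial.eval x (MvPolynomial.pderiv i f) * v i = 0}
  zero_mem' := by
    intro f _
    simp
  add_mem' := by
    intro v w hv hw f hf
    simp only [Pi.add_apply, mul_add, Finset.sum_add_distrib, hv f hf, hw f hf, add_zero]
  smul_mem' := by
    intro c v hv f hf
    simp only [Pi.smul_apply, smul_eq_mul, mul_left_comm _ c, ← Finset.mul_sum, hv f hf, mul_zero]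

/-- `X` is a smooth closed algebraic subset of `ℂ^σ` of dimension `n`: its coordinate ring has
Krull dimension `n` and `dim T_x X = n` at every point `x` of `X`. -/
structure IsSmoothAlgebraicSet {σ : Type*} [Fintype σ] (n : ℕ) (X : Set (σ → ℂ)) : Prop where
  isAlgebraicSet : IsAlgebraicSet X
  dim_eq : ringKrullDim (MvPolynomial σ ℂ ⧸ MvPolynomial.vanishingIdeal ℂ X) = n
  finrank_tangentSpaceAt : ∀ x ∈ X, Module.finrank ℂ (tangentSpaceAt X x) = n

/-- The set `S` has an isolated point (in the usual topology of `ℂ^σ`). -/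
def HasIsolatedPoint {σ : Type*} (S : Set (σ → ℂ)) : Prop :=
  ∃ p, ∃ U : Set (σ → ℂ), IsOpen U ∧ S ∩ U = {p}

/-- Very general position: for some `x ∈ X` the set `T_x X ∩ X` has an isolated point, where
`T_x X` is the linear subspace. -/
def InVeryGeneralPosition {σ : Type*} [Fintype σ] (X : Set (σ → ℂ)) : Prop :=
  ∃ x ∈ X, HasIsolatedPoint ((tangentSpaceAt X x : Set (σ → ℂ)) ∩ X)

/-- The variant of very general position with the affine tangent space `x + T_x X`. -/
def InAffineVeryGeneralPosition {σ : Type*} [Fintype σ] (X : Set (σ → ℂ)) : Prop :=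
  ∃ x ∈ X, HasIsolatedPoint ({y | y - x ∈ tangentSpaceAt X x} ∩ X)

/-- General position: `T_x X ⊕ T_y X` is the whole space for some `x, y ∈ X`. -/
def InGeneralPosition {σ : Type*} [Fintype σ] (X : Set (σ → ℂ)) : Prop :=
  ∃ x ∈ X, ∃ y ∈ X, IsCompl (tangentSpaceAt X x) (tangentSpaceAt X y)

/-- The product `X × Y` as a subset of affine space `ℂ^(σ ⊕ τ) = ℂ^σ × ℂ^τ`. -/
def affineProd {σ τ : Type*} (X : Set (σ → ℂ)) (Y : Set (τ → ℂ)) : Set (σ ⊕ τ → ℂ) :=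
  {z | z ∘ Sum.inl ∈ X ∧ z ∘ Sum.inr ∈ Y}

/-- `P` holds at a generic point of `X`: it holds on `X \ W` for a Zariski closed set `W` such that
the relatively Zariski open set `X \ W` is Zariski dense in `X`. -/
def HoldsGenerically {σ : Type*} (X : Set (σ → ℂ)) (P : (σ → ℂ) → Prop) : Prop :=
  ∃ W : Set (σ → ℂ), IsAlgebraicSet W ∧
    X ⊆ MvPolynomial.zeroLocus ℂ (MvPolynomial.vanishingIdeal ℂ (X \ W)) ∧
    ∀ z ∈ X \ W, P z

end

noncomputable section

open MvPolynomial Filter Topology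

/-! Project `ℂ^(2n)` linearly along `T_xX`. Either reading of very general position says that some
`p ∈ X` is isolated in its fibre of this projection restricted to `X`. The projection is then
generically finite on a component of `X` through `p`, hence generically unramified in characteristic
zero: `T_xX` meets `T_yX` only in `0` for some `y ∈ X`. As both spaces have dimension `n`, they are
complementary.

Isolation in the usual topology becomes isolation in the Zariski topology by
`eq_vanishingIdeal_singleton_of_isolated`, which rests on Noether normalization and compactness.
Zariski's main theorem then yields integral relations over the algebra of the projection, and
differentiating them gives unramifiedness (`exists_notMem_forall_dirDeriv_eq_zero`).

For the generic statement, transversality is implied by the nonvanishing of a determinant, and the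
product of irreducible sets is irreducible. -/

/-! ### Isolated points in the usual topology -/

/-- The constant coefficient is, up to sign, the product of the roots; take a root of least norm. -/
theorem Polynomial.Monic.exists_root_norm_pow_le {p : Polynomial ℂ} (hp : p.Monic)
    (hd : p.natDegree ≠ 0) : ∃ s, p.eval s = 0 ∧ ‖s‖ ^ p.natDegree ≤ ‖p.coeff 0‖ := by
  have hs := IsAlgClosed.splits p
  have hc : p.roots.card = p.natDegree := hs.natDegree_eq_card_roots.symm
  have hn : ‖p.coeff 0‖ = (p.roots.map norm).prod := by
    rw [hs.coeff_zero_eq_prod_roots_of_monic hp]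
    simpa using (Multiset.prod_hom p.roots (normHom : ℂ →*₀ ℝ)).symm
  have hne : p.roots.toFinset.Nonempty := by
    rw [Multiset.toFinset_nonempty]
    intro h
    rw [h, Multiset.card_zero] at hc
    exact hd hc.symm
  obtain ⟨s, hsr, hmin⟩ := p.roots.toFinset.exists_min_image norm hne
  refine ⟨s, Polynomial.isRoot_of_mem_roots (Multiset.mem_toFinset.1 hsr), ?_⟩
  rw [hn, ← hc, ← Multiset.prod_replicate, ← Multiset.map_const']
  exact Multiset.prod_map_le_prod_map₀ _ _ (fun _ _ => norm_nonneg _)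
    fun r hr => hmin r (Multiset.mem_toFinset.2 hr)

theorem exists_norm_root_le_of_isCompact {ι : Type*} {M : Polynomial (MvPolynomial ι ℂ)}
    (hM : M.Monic) {K : Set (ι → ℂ)} (hK : IsCompact K) :
    ∃ C : ℝ, ∀ t ∈ K, ∀ w, (M.map (eval t)).eval w = 0 → ‖w‖ ≤ C := by
  have hb : ∀ i, ∃ C : NNReal, ∀ t ∈ K, ‖eval t (M.coeff i)‖₊ ≤ C := by
    intro i
    obtain ⟨C, hC⟩ := hK.exists_bound_of_continuousOn
      (MvPolynomial.continuous_eval (M.coeff i)).continuousOn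
    exact ⟨C.toNNReal, fun t ht => by
      rw [← NNReal.coe_le_coe]; exact (hC t ht).trans (Real.le_coe_toNNReal C)⟩
  choose C hC using hb
  refine ⟨((Finset.range M.natDegree).sup C + 1 : NNReal), fun t ht w hw => ?_⟩
  have hmon := hM.map (eval t)
  have h := Polynomial.IsRoot.norm_lt_cauchyBound hmon.ne_zero hw
  refine (NNReal.coe_le_coe.2 h.le).trans (NNReal.coe_le_coe.2 ?_)
  rw [Polynomial.cauchyBound, hmon.leadingCoeff, hM.natDegree_map]
  simp only [nnnorm_one, div_one, Polynomial.coeff_map]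
  gcongr with i
  exact hC i t ht

/-- The points of an integral extension lying over a given point, with prescribed value of a given
function. -/
theorem exists_algHom_extension {B A : Type*} [CommRing B] [CommRing A] [IsDomain B] [IsDomain A]
    [IsIntegrallyClosed B] [Algebra ℂ B] [Algebra ℂ A] [Algebra B A] [IsScalarTower ℂ B A]
    [Module.IsTorsionFree B A] [Algebra.IsIntegral B A] [Algebra.FiniteType ℂ A]
    (u : A) (β : B →ₐ[ℂ] ℂ) (s : ℂ)
    (hs : ((minpoly B u).map (β : B →+* ℂ)).eval s = 0) :
    ∃ α : A →ₐ[ℂ] ℂ, (∀ b, α (algebraMap B A b) = β b) ∧ α u = s := by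
  let ψ : Polynomial B →ₐ[B] A := Polynomial.aeval u
  let θ : Polynomial B →+* ℂ := Polynomial.eval₂RingHom (β : B →+* ℂ) s
  have hθ : Function.Surjective θ := fun z => ⟨Polynomial.C (algebraMap ℂ B z), by simp [θ]⟩
  have hP : (RingHom.ker θ).IsMaximal := RingHom.ker_isMaximal_of_surjective θ hθ
  let _ : Algebra (Polynomial B) A := ψ.toRingHom.toAlgebra
  have : IsScalarTower B (Polynomial B) A := IsScalarTower.of_algebraMap_eq fun b =>
    (Polynomial.aeval_C u b).symm
  have : Algebra.IsIntegral (Polynomial B) A := Algebra.IsIntegral.tower_top (R := B)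
  -- As `B` is integrally closed, every relation of `u` is a multiple of `minpoly B u`. Hence the
  -- point `(β, s)` kills the kernel of `B[T] → A`, and lying over applies.
  have hle : Ideal.comap (algebraMap (Polynomial B) A) ⊥ ≤ RingHom.ker θ := by
    intro f hf
    have hf' : Polynomial.aeval u f = 0 := hf
    obtain ⟨g, rfl⟩ := minpoly.isIntegrallyClosed_dvd (Algebra.IsIntegral.isIntegral u) hf'
    rw [RingHom.mem_ker, map_mul]
    have : θ (minpoly B u) = 0 := by
      rw [← hs]; simp [θ, Polynomial.eval_map]
    rw [this, zero_mul]
  obtain ⟨Q, -, hQ, hQP⟩ := Ideal.exists_ideal_over_prime_of_isIntegral (RingHom.ker θ) ⊥ hle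
  have hQm : Q.IsMaximal :=
    Ideal.isMaximal_of_isIntegral_of_isMaximal_comap Q (hQP ▸ hP)
  let _ : Field (A ⧸ Q) := Ideal.Quotient.field Q
  have : Module.Finite ℂ (A ⧸ Q) := finite_of_finite_type_of_isJacobsonRing ℂ (A ⧸ Q)
  have hbij : Function.Bijective (algebraMap ℂ (A ⧸ Q)) :=
    IsAlgClosed.algebraMap_bijective_of_isIntegral
  let e : ℂ ≃ₐ[ℂ] (A ⧸ Q) := AlgEquiv.ofBijective (Algebra.ofId ℂ (A ⧸ Q)) hbij
  let α : A →ₐ[ℂ] ℂ := e.symm.toAlgHom.comp (Ideal.Quotient.mkₐ ℂ Q)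
  have hα : ∀ f : Polynomial B, α (ψ f) = θ f := by
    intro f
    have : f - Polynomial.C (algebraMap ℂ B (θ f)) ∈ RingHom.ker θ := by
      rw [RingHom.mem_ker, map_sub]; simp [θ]
    rw [← hQP, Ideal.mem_comap] at this
    have h2 : α (ψ (f - Polynomial.C (algebraMap ℂ B (θ f)))) = 0 := by
      change e.symm (Ideal.Quotient.mk Q (algebraMap (Polynomial B) A _)) = 0
      rw [Ideal.Quotient.eq_zero_iff_mem.2 this, map_zero]
    rw [map_sub, map_sub, sub_eq_zero] at h2
    rw [h2]
    simp only [ψ, Polynomial.aeval_C, ← IsScalarTower.algebraMap_apply, AlgHom.commutes]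
    rfl
  refine ⟨α, fun b => ?_, ?_⟩
  · simpa [ψ, θ] using hα (Polynomial.C b)
  · simpa [ψ, θ] using hα Polynomial.X

/-- Take a product vanishing on `F` away from `x` but not at `x`, and subtract its value at `x`. -/
theorem exists_eval_eq_zero_of_finite {σ : Type*} {F : Set (σ → ℂ)} (hF : F.Finite) (x : σ → ℂ) :
    ∃ u : MvPolynomial σ ℂ, eval x u = 0 ∧ ∀ y ∈ F, eval y u = 0 → y = x := by
  classical
  have hj : ∀ y : σ → ℂ, y ≠ x → ∃ j, x j ≠ y j := fun y hy => by
    by_contra! h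
    exact hy (funext fun j => (h j).symm)
  have hl : ∀ y : σ → ℂ, ∃ l : MvPolynomial σ ℂ, eval y l = 0 ∧ (y ≠ x → eval x l ≠ 0) := by
    intro y
    by_cases hy : y = x
    · exact ⟨0, by simp, fun h => (h hy).elim⟩
    · obtain ⟨j, hj⟩ := hj y hy
      exact ⟨X j - C (y j), by simp, fun _ => by simpa [sub_eq_zero] using hj⟩
  choose l hl0 hl1 using hl
  let f := ∏ y ∈ hF.toFinset.filter (· ≠ x), l y
  have hfx : eval x f ≠ 0 := by
    rw [map_prod]
    exact Finset.prod_ne_zero_iff.2 fun y hy => hl1 y (Finset.mem_filter.1 hy).2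
  refine ⟨f - C (eval x f), by simp, fun y hy h => ?_⟩
  by_contra hyx
  have hfy : eval y f = 0 := by
    rw [map_prod]
    exact Finset.prod_eq_zero (Finset.mem_filter.2 ⟨hF.mem_toFinset.2 hy, hyx⟩) (hl0 y)
  rw [map_sub, hfy, eval_C, zero_sub, neg_eq_zero] at h
  exact hfx h

/-- A point of an irreducible affine variety which is isolated in the usual topology is the whole
variety. -/
theorem eq_vanishingIdeal_singleton_of_isolated {σ : Type*} [Fintype σ]
    (q : Ideal (MvPolynomial σ ℂ)) [hq : q.IsPrime] {x : σ → ℂ} {U : Set (σ → ℂ)} (hU : IsOpen U)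
    (h : zeroLocus ℂ q ∩ U = {x}) : q = vanishingIdeal ℂ {x} := by
  have hx : x ∈ zeroLocus ℂ q ∩ U := h ▸ rfl
  have hqx : q ≤ vanishingIdeal ℂ {x} :=
    le_zeroLocus_iff_le_vanishingIdeal.1 (Set.singleton_subset_iff.2 hx.1)
  obtain ⟨s, g, ginj, gint⟩ := exists_integral_inj_algHom_of_fg ℂ (MvPolynomial σ ℂ ⧸ q)
  let _ : Algebra (MvPolynomial (Fin s) ℂ) (MvPolynomial σ ℂ ⧸ q) := g.toRingHom.toAlgebra
  have halg : ∀ b, algebraMap (MvPolynomial (Fin s) ℂ) (MvPolynomial σ ℂ ⧸ q) b = g b :=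
    fun _ => rfl
  have : IsScalarTower ℂ (MvPolynomial (Fin s) ℂ) (MvPolynomial σ ℂ ⧸ q) :=
    IsScalarTower.of_algebraMap_eq fun b => (g.commutes b).symm
  have : Algebra.IsIntegral (MvPolynomial (Fin s) ℂ) (MvPolynomial σ ℂ ⧸ q) := ⟨gint⟩
  have : FaithfulSMul (MvPolynomial (Fin s) ℂ) (MvPolynomial σ ℂ ⧸ q) :=
    (faithfulSMul_iff_algebraMap_injective _ _).2 ginj
  rcases s with _ | s
  -- Over a zero-dimensional base the coordinate ring is a field, so `q` is already maximal.
  · have hf : IsField (MvPolynomial (Fin 0) ℂ) :=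
      (isEmptyRingEquiv ℂ (Fin 0)).toMulEquiv.isField (Field.toIsField ℂ)
    have hA := isField_of_isIntegral_of_isField' (S := MvPolynomial σ ℂ ⧸ q) hf
    have hqm : q.IsMaximal := Ideal.Quotient.maximal_of_isField q hA
    exact hqm.eq_of_le (Ideal.IsPrime.ne_top inferInstance) hqx
  exfalso
  have hG : ∀ i, ∃ G : MvPolynomial σ ℂ, Ideal.Quotient.mk q G = g (X i) :=
    fun i => Ideal.Quotient.mk_surjective _
  choose G hG using hG
  have hroot : ∀ z ∈ zeroLocus ℂ q, ∀ t : Fin (s + 1) → ℂ, (∀ i, eval z (G i) = t i) →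
      ∀ f, ((minpoly (MvPolynomial (Fin (s + 1)) ℂ) (Ideal.Quotient.mk q f)).map (eval t)).eval
        (eval z f) = 0 := by
    intro z hz t ht f
    let α : (MvPolynomial σ ℂ ⧸ q) →ₐ[ℂ] ℂ := Ideal.Quotient.liftₐ q (aeval z) hz
    have hα : ∀ f, α (Ideal.Quotient.mk q f) = eval z f := fun f => rfl
    have hαg : α.comp g = aeval t := by
      ext i
      simp [← hG, hα, ht]
    have := congrArg α (minpoly.aeval (MvPolynomial (Fin (s + 1)) ℂ) (Ideal.Quotient.mk q f))
    rw [map_zero, Polynomial.aeval_def, ← AlgHom.coe_toRingHom, Polynomial.hom_eval₂,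
      AlgHom.coe_toRingHom, hα] at this
    rw [Polynomial.eval_map, ← this]
    congr 1
    exact RingHom.ext fun b => (DFunLike.congr_fun hαg b).symm
  let a : Fin (s + 1) → ℂ := fun i => eval x (G i)
  have hmon : ∀ f, (minpoly (MvPolynomial (Fin (s + 1)) ℂ) (Ideal.Quotient.mk q f)).Monic :=
    fun f => minpoly.monic (Algebra.IsIntegral.isIntegral _)
  have hfin : {z | z ∈ zeroLocus ℂ q ∧ ∀ i, eval z (G i) = a i}.Finite := by
    refine (Set.Finite.pi' fun j : σ => Polynomial.finite_setOfPred_isRoot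
      ((hmon (X j)).map (eval a)).ne_zero).subset ?_
    rintro z ⟨hz, hza⟩ j
    simpa using hroot z hz a hza (X j)
  obtain ⟨u, hux, hu⟩ := exists_eval_eq_zero_of_finite hfin x
  set M := minpoly (MvPolynomial (Fin (s + 1)) ℂ) (Ideal.Quotient.mk q u)
  have hd : M.natDegree ≠ 0 :=
    (minpoly.natDegree_pos (Algebra.IsIntegral.isIntegral _)).ne'
  -- Over every `t` lies a point of the variety at which `u` is as small as the constant coefficient
  -- of `M` forces some root to be.
  have hlift : ∀ t : Fin (s + 1) → ℂ, ∃ z ∈ zeroLocus ℂ q, (∀ i, eval z (G i) = t i) ∧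
      ‖eval z u‖ ^ M.natDegree ≤ ‖eval t (M.coeff 0)‖ := by
    intro t
    obtain ⟨w, hw, hwn⟩ := ((hmon u).map (eval t)).exists_root_norm_pow_le
      (by rwa [(hmon u).natDegree_map])
    rw [(hmon u).natDegree_map, Polynomial.coeff_map] at hwn
    obtain ⟨α, hα, hαu⟩ := exists_algHom_extension (Ideal.Quotient.mk q u)
      (aeval t : MvPolynomial (Fin (s + 1)) ℂ →ₐ[ℂ] ℂ) w hw
    let z : σ → ℂ := fun j => α (Ideal.Quotient.mk q (X j))
    have hz : α.comp (Ideal.Quotient.mkₐ ℂ q) = aeval z := by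
      ext j
      simp [z]
    have hz' : ∀ f, eval z f = α (Ideal.Quotient.mk q f) := fun f =>
      (DFunLike.congr_fun hz f).symm
    refine ⟨z, fun f hf => ?_, fun i => ?_, ?_⟩
    · change eval z f = 0
      rw [hz', Ideal.Quotient.eq_zero_iff_mem.2 hf, map_zero]
    · rw [hz', hG, ← halg, hα]
      simp
    · rw [hz', hαu]
      exact hwn
  choose Z hZq hZG hZu using hlift
  have hb : ∀ j, ∃ c, ∀ t ∈ Metric.closedBall a 1, ‖Z t j‖ ≤ c := fun j => by
    obtain ⟨c, hc⟩ := exists_norm_root_le_of_isCompact (hmon (X j)) (isCompact_closedBall a 1)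
    exact ⟨c, fun t ht => hc t ht _ (by simpa using hroot _ (hZq t) t (hZG t) (X j))⟩
  choose c hc using hb
  -- Parameters `t k ≠ a` tending to `a`. The lifts `Z (t k)` accumulate at a point over `a` where
  -- `u` vanishes, which is `x`; isolation then forces some lift to equal `x`, although `x` lies
  -- over `a`.
  let t : ℕ → Fin (s + 1) → ℂ := fun k => a + Pi.single 0 (1 / ((k : ℂ) + 1))
  have hta : Tendsto t atTop (𝓝 a) := by
    have h1 : Tendsto (fun k : ℕ => (Pi.single 0 (1 / ((k : ℂ) + 1)) : Fin (s + 1) → ℂ)) atTop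
        (𝓝 (Pi.single 0 0)) :=
      ((continuous_single (A := fun _ : Fin (s + 1) => ℂ) 0).tendsto 0).comp
        tendsto_one_div_add_atTop_nhds_zero_nat
    simpa [t] using h1.const_add a
  have htK : ∀ k, t k ∈ Metric.closedBall a 1 := by
    intro k
    rw [mem_closedBall_iff_norm, add_sub_cancel_left, Pi.norm_single, norm_div, norm_one]
    have : ‖(k : ℂ) + 1‖ = k + 1 := by exact_mod_cast Complex.norm_natCast (k + 1)
    rw [this]
    exact div_le_one_of_le₀ (by linarith [(Nat.cast_nonneg k : (0 : ℝ) ≤ k)]) (by positivity)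
  obtain ⟨z, -, φ, hφ, hzφ⟩ := (isCompact_univ_pi fun j =>
    isCompact_closedBall (0 : ℂ) (c j)).tendsto_subseq (x := fun k => Z (t k)) fun k j _ => by simpa using hc j _ (htK k)
  have htφ := hta.comp hφ.tendsto_atTop
  have hzq : z ∈ zeroLocus ℂ q := fun f hf =>
    tendsto_nhds_unique (((continuous_eval f).tendsto z).comp hzφ)
      (tendsto_const_nhds.congr fun k => (hZq (t (φ k)) f hf).symm)
  have hza : ∀ i, eval z (G i) = a i := fun i =>
    tendsto_nhds_unique (((continuous_eval (G i)).tendsto z).comp hzφ)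
      ((((continuous_apply i).tendsto a).comp htφ).congr fun k => (hZG (t (φ k)) i).symm)
  have ha0 : eval a (M.coeff 0) = 0 := by
    have := hroot x hx.1 a (fun _ => rfl) u
    rwa [hux, ← Polynomial.coeff_zero_eq_eval_zero, Polynomial.coeff_map] at this
  have hzu : eval z u = 0 := by
    have := le_of_tendsto_of_tendsto'
      (((((continuous_eval u).norm.pow M.natDegree).tendsto z)).comp hzφ)
      (((continuous_eval (M.coeff 0)).norm.tendsto a).comp htφ) fun k => hZu (t (φ k))
    rw [ha0, norm_zero] at this
    exact norm_eq_zero.1 (pow_eq_zero_iff hd |>.1 (le_antisymm this (by positivity)))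
  obtain rfl := hu z ⟨hzq, hza⟩ hzu
  obtain ⟨k, hk⟩ := (hzφ.eventually (hU.mem_nhds hx.2)).exists
  have hzk : Z (t (φ k)) = z := by
    have : Z (t (φ k)) ∈ zeroLocus ℂ q ∩ U := ⟨hZq _, hk⟩
    rwa [h] at this
  have := hZG (t (φ k)) 0
  rw [hzk, hza] at this
  simp only [t, Pi.add_apply, Pi.single_eq_same, left_eq_add, one_div, inv_eq_zero] at this
  exact Nat.cast_add_one_ne_zero _ this

theorem Ideal.exists_notMem_forall_mem_of_finite {S : Type*} [CommRing S] {P : Ideal S}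
    (hP : P.IsPrime) {Q : Set (Ideal S)} (hQ : Q.Finite) (h : ∀ q ∈ Q, ¬ q ≤ P) :
    ∃ f, f ∉ P ∧ ∀ q ∈ Q, f ∈ q := by
  have h1 : ¬ hQ.toFinset.inf id ≤ P := by
    rw [hP.inf_le']
    rintro ⟨q, hq, hqP⟩
    exact h q (hQ.mem_toFinset.1 hq) hqP
  obtain ⟨f, hf, hfP⟩ := SetLike.not_le_iff_exists.1 h1
  exact ⟨f, hfP, fun q hq => (Finset.inf_le (f := id) (hQ.mem_toFinset.2 hq)) hf⟩

/-! ### Directional derivatives and separable relations -/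

section dirDeriv

variable {σ : Type*} [Fintype σ]

/-- The derivative at `y` of a polynomial in the direction of `v`. -/
def dirDeriv (y v : σ → ℂ) : MvPolynomial σ ℂ →ₗ[ℂ] ℂ where
  toFun f := ∑ i, eval y (pderiv i f) * v i
  map_add' f g := by simp only [map_add, add_mul, Finset.sum_add_distrib]
  map_smul' c f := by
    simp only [Derivation.map_smul, smul_eval, RingHom.id_apply, smul_eq_mul, Finset.mul_sum,
      mul_assoc]

theorem dirDeriv_apply (y v : σ → ℂ) (f : MvPolynomial σ ℂ) :
    dirDeriv y v f = ∑ i, eval y (pderiv i f) * v i := rfl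

theorem dirDeriv_mul (y v : σ → ℂ) (f g : MvPolynomial σ ℂ) :
    dirDeriv y v (f * g) = eval y f * dirDeriv y v g + eval y g * dirDeriv y v f := by
  simp only [dirDeriv_apply, Finset.mul_sum, ← Finset.sum_add_distrib]
  refine Finset.sum_congr rfl fun i _ => ?_
  rw [Derivation.leibniz]
  simp only [smul_eq_mul, map_add, map_mul]
  ring

@[simp]
theorem dirDeriv_C (y v : σ → ℂ) (c : ℂ) : dirDeriv y v (C c) = 0 := by
  simp [dirDeriv_apply]

@[simp]
theorem dirDeriv_X (y v : σ → ℂ) (j : σ) : dirDeriv y v (X j) = v j := by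
  classical
  simp [dirDeriv_apply, pderiv_X, Pi.single_apply, apply_ite]

theorem dirDeriv_pow (y v : σ → ℂ) (f : MvPolynomial σ ℂ) (n : ℕ) :
    dirDeriv y v (f ^ n) = n * eval y f ^ (n - 1) * dirDeriv y v f := by
  induction n with
  | zero => simpa using dirDeriv_C y v 1
  | succ n ih =>
    rw [pow_succ, dirDeriv_mul, ih]
    rcases n with _ | n
    · simp
    · simp only [Nat.add_sub_cancel, map_pow]
      push_cast
      ring

theorem dirDeriv_aeval {R : Subalgebra ℂ (MvPolynomial σ ℂ)} {y v : σ → ℂ}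
    (hR : ∀ r ∈ R, dirDeriv y v r = 0) (b : MvPolynomial σ ℂ) (Q : Polynomial R) :
    dirDeriv y v (Polynomial.aeval b Q) =
      eval y (Polynomial.aeval b (Polynomial.derivative Q)) * dirDeriv y v b := by
  induction Q using Polynomial.induction_on' with
  | add p q hp hq => simp only [map_add, hp, hq, add_mul]
  | monomial n r =>
    rw [Polynomial.derivative_monomial, Polynomial.aeval_monomial, Polynomial.aeval_monomial,
      dirDeriv_mul, show dirDeriv y v (algebraMap R _ r) = 0 from hR _ r.2, dirDeriv_pow]
    simp only [map_mul, map_pow, map_natCast]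
    ring

end dirDeriv

/-- Take a relation of least degree among those nonzero modulo `P`. In characteristic zero its
derivative is nonzero of smaller degree, hence not a relation. -/
theorem exists_aeval_mem_derivative_notMem {S : Type*} [CommRing S] [Algebra ℂ S]
    {R : Subalgebra ℂ S} {P : Ideal S} [P.IsPrime] {b : S}
    (hb : IsIntegral R (Ideal.Quotient.mk P b)) :
    ∃ Q : Polynomial R, Polynomial.aeval b Q ∈ P ∧
      Polynomial.aeval b (Polynomial.derivative Q) ∉ P := by
  classical
  have hmem : ∀ Q : Polynomial R, Polynomial.aeval b Q ∈ P ↔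
      (Q.map (algebraMap R (S ⧸ P))).eval (Ideal.Quotient.mk P b) = 0 := by
    intro Q
    rw [← Ideal.Quotient.eq_zero_iff_mem, Polynomial.eval_map, ← Polynomial.aeval_def,
      ← Ideal.Quotient.algebraMap_eq, Polynomial.aeval_algebraMap_apply]
  have hex : ∃ n, ∃ Q : Polynomial R, Q.map (algebraMap R (S ⧸ P)) ≠ 0 ∧
      (Q.map (algebraMap R (S ⧸ P))).natDegree = n ∧ Polynomial.aeval b Q ∈ P := by
    obtain ⟨Q, hQ, hQb⟩ := hb
    refine ⟨_, Q, (hQ.map _).ne_zero, rfl, ?_⟩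
    rw [hmem, Polynomial.eval_map]
    exact hQb
  obtain ⟨Q, hQ0, hQn, hQP⟩ := Nat.find_spec hex
  have : CharZero (S ⧸ P) := charZero_of_injective_algebraMap (algebraMap ℂ (S ⧸ P)).injective
  refine ⟨Q, hQP, fun hd => ?_⟩
  have hnd : (Q.map (algebraMap R (S ⧸ P))).natDegree ≠ 0 := by
    intro h
    rw [hmem, Polynomial.eq_C_of_natDegree_eq_zero h, Polynomial.eval_C] at hQP
    rw [Polynomial.eq_C_of_natDegree_eq_zero h, hQP, Polynomial.C_0] at hQ0
    exact hQ0 rfl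
  have hlt := Polynomial.natDegree_derivative_lt hnd
  rw [Polynomial.derivative_map] at hlt
  refine Nat.find_min hex (hQn ▸ hlt) ⟨_, ?_, rfl, hd⟩
  rw [← Polynomial.derivative_map]
  exact fun h => hnd (Polynomial.derivative_eq_zero.1 h)

/-! ### Linear projections and Zariski's main theorem -/

section

variable {σ : Type*} [Fintype σ]

/-- The homogeneous linear polynomial with coefficient vector `c`. -/
def linearPoly (c : σ → ℂ) : MvPolynomial σ ℂ := ∑ i, C (c i) * X i

theorem eval_linearPoly (c y : σ → ℂ) : eval y (linearPoly c) = ∑ i, c i * y i := by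
  simp [linearPoly]

theorem dirDeriv_linearPoly (c y v : σ → ℂ) : dirDeriv y v (linearPoly c) = ∑ i, c i * v i := by
  simp [linearPoly, dirDeriv_mul]

theorem dirDeriv_eq_zero_of_mem_adjoin {S : Set (σ → ℂ)} {y v : σ → ℂ}
    (hv : ∀ c ∈ S, ∑ i, c i * v i = 0) {r : MvPolynomial σ ℂ}
    (hr : r ∈ Algebra.adjoin ℂ (linearPoly '' S)) : dirDeriv y v r = 0 := by
  induction hr using Algebra.adjoin_induction with
  | mem f hf =>
    obtain ⟨c, hc, rfl⟩ := hf
    rw [dirDeriv_linearPoly, hv c hc]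
  | algebraMap z => exact dirDeriv_C y v z
  | add f g _ _ hf hg => rw [map_add, hf, hg, add_zero]
  | mul f g _ _ hf hg => rw [dirDeriv_mul, hf, hg, mul_zero, mul_zero, add_zero]

theorem quasiFiniteAt_of_isolated {S : Set (σ → ℂ)} {P : Ideal (MvPolynomial σ ℂ)} [P.IsPrime]
    {p : σ → ℂ} {U : Set (σ → ℂ)} (hU : IsOpen U)
    (h : {y | y ∈ zeroLocus ℂ P ∧ ∀ c ∈ S, ∑ i, c i * y i = ∑ i, c i * p i} ∩ U = {p}) :
    ∃ q : PrimeSpectrum (MvPolynomial σ ℂ ⧸ P),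
      Algebra.QuasiFiniteAt (Algebra.adjoin ℂ (linearPoly '' S)) q.asIdeal := by
  have hp := h.ge (Set.mem_singleton p)
  obtain ⟨⟨hpP, -⟩, hpU⟩ := hp
  set R := Algebra.adjoin ℂ (linearPoly '' S)
  let L : (σ → ℂ) → MvPolynomial σ ℂ := fun c => linearPoly c - C (eval p (linearPoly c))
  let J : Ideal (MvPolynomial σ ℂ) := P ⊔ Ideal.span (L '' S)
  have hJ : ∀ q : Ideal (MvPolynomial σ ℂ), q.IsPrime → J ≤ q → q ≤ vanishingIdeal ℂ {p} →
      q = vanishingIdeal ℂ {p} := by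
    intro q hq hJq hqp
    refine eq_vanishingIdeal_singleton_of_isolated q hU (Set.Subset.antisymm ?_ ?_)
    · rintro y ⟨hy, hyU⟩
      rw [← h]
      refine ⟨⟨fun f hf => hy f (hJq (Ideal.mem_sup_left hf)), fun c hc => ?_⟩, hyU⟩
      have : eval y (L c) = 0 :=
        hy (L c) (hJq (Ideal.mem_sup_right (Ideal.subset_span ⟨c, hc, rfl⟩)))
      simpa [L, eval_linearPoly, sub_eq_zero] using this
    · rintro _ rfl
      exact ⟨fun f hf => hqp hf _ rfl, hpU⟩
  -- `J` defines the fibre through `p`. The function `f` vanishes on its components other than `{p}`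
  -- but not at `p`, so its basic open set isolates `p` in the fibre.
  obtain ⟨f, hfp, hf⟩ := Ideal.exists_notMem_forall_mem_of_finite
    (P := vanishingIdeal ℂ {p}) inferInstance
    (((Ideal.finite_minimalPrimes_of_isNoetherianRing _ J)).subset
      (Set.sdiff_subset (t := {vanishingIdeal ℂ {p}})))
    (fun q hq hqp => hq.2 (hJ q hq.1.1.1 hq.1.1.2 hqp))
  let α : (MvPolynomial σ ℂ ⧸ P) →ₐ[ℂ] ℂ := Ideal.Quotient.liftₐ P (aeval p) hpP
  have hα : ∀ f, α (Ideal.Quotient.mk P f) = eval p f := fun f => rfl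
  let q₀ : PrimeSpectrum (MvPolynomial σ ℂ ⧸ P) := ⟨RingHom.ker α, RingHom.ker_isPrime _⟩
  have hq₀ : q₀.asIdeal.comap (Ideal.Quotient.mk P) = vanishingIdeal ℂ {p} := by
    ext g
    rw [mem_vanishingIdeal_singleton_iff]
    rfl
  have : Algebra.FiniteType R (MvPolynomial σ ℂ ⧸ P) :=
    Algebra.FiniteType.of_restrictScalars_finiteType ℂ R _
  refine ⟨q₀, Algebra.QuasiFiniteAt.of_isOpen_singleton_fiber q₀ ?_⟩
  refine ⟨PrimeSpectrum.basicOpen (Ideal.Quotient.mk P f), PrimeSpectrum.isOpen_basicOpen, ?_⟩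
  ext ⟨q, hq⟩
  simp only [Set.mem_preimage, Set.mem_singleton_iff]
  constructor
  · intro hfq
    have hfq' : f ∉ q.asIdeal.comap (Ideal.Quotient.mk P) := hfq
    have hJq : J ≤ q.asIdeal.comap (Ideal.Quotient.mk P) := by
      refine sup_le ?_ (Ideal.span_le.2 ?_)
      · intro g hg
        rw [Ideal.mem_comap, Ideal.Quotient.eq_zero_iff_mem.2 hg]
        exact zero_mem _
      · rintro _ ⟨c, hc, rfl⟩
        have hcR : L c ∈ R := sub_mem (Algebra.subset_adjoin ⟨c, hc, rfl⟩) (R.algebraMap_mem _)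
        have : (⟨L c, hcR⟩ : R) ∈ q.asIdeal.comap (algebraMap R (MvPolynomial σ ℂ ⧸ P)) := by
          have hq' := congrArg PrimeSpectrum.asIdeal (show PrimeSpectrum.comap _ q = _ from hq)
          rw [PrimeSpectrum.comap_asIdeal, PrimeSpectrum.comap_asIdeal] at hq'
          rw [hq']
          change α (Ideal.Quotient.mk P (L c)) = 0
          rw [hα]
          simp [L]
        exact this
    obtain ⟨𝔮, h𝔮, h𝔮q⟩ := Ideal.exists_minimalPrimes_le hJq
    have h𝔮p : 𝔮 = vanishingIdeal ℂ {p} := by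
      by_contra hne
      exact hfq' (h𝔮q (hf 𝔮 ⟨h𝔮, hne⟩))
    have hmax : (vanishingIdeal ℂ {p} : Ideal (MvPolynomial σ ℂ)).IsMaximal := inferInstance
    have := hmax.eq_of_le (Ideal.IsPrime.ne_top inferInstance) (h𝔮p ▸ h𝔮q)
    rw [← hq₀] at this
    refine Subtype.ext (PrimeSpectrum.ext ?_)
    exact (Ideal.comap_injective_of_surjective _ Ideal.Quotient.mk_surjective this).symm
  · intro hqq
    obtain rfl : q = q₀ := congrArg Subtype.val hqq
    change f ∉ q₀.asIdeal.comap (Ideal.Quotient.mk P)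
    rwa [hq₀]

/-- Zariski's main theorem gives `r ∉ P` such that `r` and all `r ^ m j * X j` are integral modulo
`P` over the algebra of the forms in `S`. Those forms are constant along `v`, so differentiating
separable relations kills the derivative of `r`, and then `r ^ m j * v j`. The factors of `d` are
what must be cancelled. -/
theorem exists_notMem_forall_dirDeriv_eq_zero {S : Set (σ → ℂ)} {P : Ideal (MvPolynomial σ ℂ)}
    [P.IsPrime] {p : σ → ℂ} {U : Set (σ → ℂ)} (hU : IsOpen U)
    (h : {y | y ∈ zeroLocus ℂ P ∧ ∀ c ∈ S, ∑ i, c i * y i = ∑ i, c i * p i} ∩ U = {p}) :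
    ∃ d, d ∉ P ∧ ∀ y ∈ zeroLocus ℂ P, eval y d ≠ 0 → ∀ v, (∀ f ∈ P, dirDeriv y v f = 0) →
      (∀ c ∈ S, ∑ i, c i * v i = 0) → v = 0 := by
  obtain ⟨q, hq⟩ := quasiFiniteAt_of_isolated hU h
  have : Algebra.FiniteType (Algebra.adjoin ℂ (linearPoly '' S)) (MvPolynomial σ ℂ ⧸ P) :=
    Algebra.FiniteType.of_restrictScalars_finiteType ℂ _ _
  obtain ⟨r, hrq, hr, hrx⟩ := Algebra.zariskisMainProperty_iff.1
    (Algebra.ZariskisMainProperty.of_finiteType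
      (R := Algebra.adjoin ℂ (linearPoly '' S)) q.asIdeal)
  obtain ⟨r, rfl⟩ := Ideal.Quotient.mk_surjective r
  have hrP : r ∉ P := fun hmem => hrq (by
    rw [Ideal.Quotient.eq_zero_iff_mem.2 hmem]
    exact zero_mem _)
  choose m hm using fun j : σ => hrx (Ideal.Quotient.mk P (X j))
  obtain ⟨Q, hQ, hQ'⟩ := exists_aeval_mem_derivative_notMem hr
  have hm' : ∀ j, IsIntegral (Algebra.adjoin ℂ (linearPoly '' S))
      (Ideal.Quotient.mk P (r ^ m j * X j)) := fun j => by simpa using hm j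
  choose G hG hG' using fun j => exists_aeval_mem_derivative_notMem (hm' j)
  have hP : P.IsPrime := inferInstance
  refine ⟨r * Polynomial.aeval r (Polynomial.derivative Q) *
    ∏ j, Polynomial.aeval (r ^ m j * X j) (Polynomial.derivative (G j)), ?_, ?_⟩
  · refine hP.mul_notMem (hP.mul_notMem hrP hQ') ?_
    rw [hP.prod_mem_iff]
    rintro ⟨j, -, hj⟩
    exact hG' j hj
  · intro y hy hd v hv hvS
    rw [map_mul, map_mul, map_prod] at hd
    obtain ⟨⟨hd1, hd2⟩, hd3⟩ := (mul_ne_zero_iff.1 hd).imp_left mul_ne_zero_iff.1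
    rw [Finset.prod_ne_zero_iff] at hd3
    have hR : ∀ a ∈ Algebra.adjoin ℂ (linearPoly '' S), dirDeriv y v a = 0 := fun a ha =>
      dirDeriv_eq_zero_of_mem_adjoin hvS ha
    have hDr : dirDeriv y v r = 0 := by
      have := hv _ hQ
      rw [dirDeriv_aeval hR] at this
      exact (mul_eq_zero.1 this).resolve_left hd2
    funext j
    have := hv _ (hG j)
    rw [dirDeriv_aeval hR] at this
    have := (mul_eq_zero.1 this).resolve_left (hd3 j (Finset.mem_univ j))
    rw [dirDeriv_mul, dirDeriv_pow, hDr, dirDeriv_X, map_pow, mul_zero, mul_zero, add_zero] at this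
    exact (mul_eq_zero.1 this).resolve_left (pow_ne_zero _ hd1)

theorem exists_disjoint_tangentSpaceAt {X : Set (σ → ℂ)} (hX : IsAlgebraicSet X) {x p : σ → ℂ}
    {U : Set (σ → ℂ)} (hU : IsOpen U) (hp : p ∈ X) (hpU : p ∈ U)
    (h : ∀ y ∈ X, y ∈ U → y - p ∈ tangentSpaceAt X x → y = p) :
    ∃ y ∈ X, Disjoint (tangentSpaceAt X x) (tangentSpaceAt X y) := by
  obtain ⟨I, rfl⟩ := hX
  have hrad : (vanishingIdeal ℂ (zeroLocus ℂ I)).IsRadical := by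
    rw [vanishingIdeal_zeroLocus_eq_radical]
    exact Ideal.radical_isRadical I
  set X := zeroLocus ℂ I
  obtain ⟨P, hP, hPp⟩ := Ideal.exists_minimalPrimes_le
    (vanishingIdeal_anti_mono (k := ℂ) (Set.singleton_subset_iff.2 hp))
  have : P.IsPrime := hP.1.1
  have hPX : zeroLocus ℂ P ⊆ X := fun y hy f hf =>
    hy f (hP.1.2 (le_vanishingIdeal_zeroLocus I hf))
  obtain ⟨e, heP, he⟩ := Ideal.exists_notMem_forall_mem_of_finite this
    ((Ideal.finite_minimalPrimes_of_isNoetherianRing _ (vanishingIdeal ℂ X)).subset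
      (Set.sdiff_subset (t := {P})))
    (fun q hq hqP => hq.2 (le_antisymm hqP (hP.2 hq.1.1 hqP)))
  -- Since `e` vanishes on the other components, `T_yX` lies in the tangent space of the component
  -- `P` wherever `e` is nonzero.
  have heP' : ∀ f ∈ P, e * f ∈ vanishingIdeal ℂ X := by
    intro f hf
    rw [← hrad.radical, ← Ideal.sInf_minimalPrimes, Ideal.mem_sInf]
    intro q hq
    by_cases hqP : q = P
    · exact hqP ▸ Ideal.mul_mem_left _ _ hf
    · exact Ideal.mul_mem_right _ _ (he q ⟨hq, hqP⟩)
  -- The differentials at `x`: their common kernel is `T_xX`, so they define the projection along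
  -- it.
  let S : Set (σ → ℂ) := (fun f i => eval x (pderiv i f)) '' (vanishingIdeal ℂ X : Set _)
  have hS : ∀ v, (∀ c ∈ S, ∑ i, c i * v i = 0) ↔ v ∈ tangentSpaceAt X x := fun v =>
    Set.forall_mem_image
  obtain ⟨d, hdP, hd⟩ := exists_notMem_forall_dirDeriv_eq_zero (S := S) (P := P) hU (p := p) (by
    ext y
    constructor
    · rintro ⟨⟨hyP, hyS⟩, hyU⟩
      refine h y (hPX hyP) hyU ((hS _).1 fun c hc => ?_)
      simp [mul_sub, hyS c hc]
    · rintro rfl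
      exact ⟨⟨fun f hf => hPp hf _ rfl, fun c _ => rfl⟩, hpU⟩)
  have hde : d * e ∉ vanishingIdeal ℂ (zeroLocus ℂ P) := by
    rw [IsPrime.vanishingIdeal_zeroLocus]
    exact this.mul_notMem hdP heP
  obtain ⟨y, hyP, hy⟩ : ∃ y ∈ zeroLocus ℂ P, eval y (d * e) ≠ 0 := by
    by_contra! hall
    exact hde hall
  rw [map_mul] at hy
  refine ⟨y, hPX hyP, Submodule.disjoint_def.2 fun v hvx hvy => ?_⟩
  refine hd y hyP (left_ne_zero_of_mul hy) v (fun f hf => ?_) ((hS v).2 hvx)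
  have := hvy _ (heP' f hf)
  rw [← dirDeriv_apply, dirDeriv_mul, show eval y f = 0 from hyP f hf, zero_mul, add_zero] at this
  exact (mul_eq_zero.1 this).resolve_left (right_ne_zero_of_mul hy)

theorem isCompl_tangentSpaceAt {n : ℕ} {X : Set (Fin (2 * n) → ℂ)} (hX : IsSmoothAlgebraicSet n X)
    {x y : Fin (2 * n) → ℂ} (hx : x ∈ X) (hy : y ∈ X)
    (h : Disjoint (tangentSpaceAt X x) (tangentSpaceAt X y)) :
    IsCompl (tangentSpaceAt X x) (tangentSpaceAt X y) := by
  refine ⟨h, codisjoint_iff.2 (Submodule.eq_top_of_disjoint _ _ ?_ h)⟩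
  rw [hX.finrank_tangentSpaceAt x hx, hX.finrank_tangentSpaceAt y hy]
  simp
  omega

theorem inGeneralPosition_of_inVeryGeneralPosition {n : ℕ} {X : Set (Fin (2 * n) → ℂ)}
    (hX : IsSmoothAlgebraicSet n X)
    (h : InVeryGeneralPosition X ∨ InAffineVeryGeneralPosition X) : InGeneralPosition X := by
  -- The linear or affine tangent space through `p` is in both cases the translate `p + T_xX`.
  suffices ∃ x ∈ X, ∃ p ∈ X, ∃ U, IsOpen U ∧ p ∈ U ∧
      ∀ y ∈ X, y ∈ U → y - p ∈ tangentSpaceAt X x → y = p by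
    obtain ⟨x, hx, p, hp, U, hU, hpU, h⟩ := this
    obtain ⟨y, hy, hxy⟩ := exists_disjoint_tangentSpaceAt hX.isAlgebraicSet hU hp hpU h
    exact ⟨x, hx, y, hy, isCompl_tangentSpaceAt hX hx hy hxy⟩
  rcases h with ⟨x, hx, p, U, hU, h⟩ | ⟨x, hx, p, U, hU, h⟩
  · have hp := h.ge (Set.mem_singleton p)
    refine ⟨x, hx, p, hp.1.2, U, hU, hp.2, fun y hy hyU hyp => ?_⟩
    have : y ∈ (tangentSpaceAt X x : Set _) ∩ X ∩ U :=
      ⟨⟨by simpa using add_mem hyp hp.1.1, hy⟩, hyU⟩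
    rwa [h] at this
  · have hp := h.ge (Set.mem_singleton p)
    refine ⟨x, hx, p, hp.1.2, U, hU, hp.2, fun y hy hyU hyp => ?_⟩
    have : y ∈ {y | y - x ∈ tangentSpaceAt X x} ∩ X ∩ U :=
      ⟨⟨by simpa using add_mem hyp hp.1.1, hy⟩, hyU⟩
    rwa [h] at this

end

/-! ### Genericity on the product -/

theorem exists_eval_ne_zero_and {σ : Type*} {X : Set (σ → ℂ)}
    (hX : (vanishingIdeal ℂ X).IsPrime) {F G : MvPolynomial σ ℂ} {x x' : σ → ℂ} (hx : x ∈ X)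
    (hx' : x' ∈ X) (hF : eval x F ≠ 0) (hG : eval x' G ≠ 0) :
    ∃ z ∈ X, eval z F ≠ 0 ∧ eval z G ≠ 0 := by
  by_contra! h
  have hFG : F * G ∈ vanishingIdeal ℂ X := fun z hz => by
    change eval z (F * G) = 0
    rw [map_mul, mul_eq_zero, or_iff_not_imp_left]
    exact h z hz
  rcases hX.mem_or_mem hFG with h | h
  · exact hF (h x hx)
  · exact hG (h x' hx')

/-- Irreducibility of the product, one factor at a time: fix the second coordinates to find `a`,
then fix `a` to find `b`. -/
theorem exists_eval_sumElim_ne_zero_and {σ τ : Type*} {X : Set (σ → ℂ)} {Y : Set (τ → ℂ)}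
    (hX : (vanishingIdeal ℂ X).IsPrime) (hY : (vanishingIdeal ℂ Y).IsPrime)
    {F G : MvPolynomial (σ ⊕ τ) ℂ} {x x' : σ → ℂ} {y y' : τ → ℂ} (hx : x ∈ X) (hx' : x' ∈ X)
    (hy : y ∈ Y) (hy' : y' ∈ Y) (hF : eval (Sum.elim x y) F ≠ 0)
    (hG : eval (Sum.elim x' y') G ≠ 0) :
    ∃ a ∈ X, ∃ b ∈ Y, eval (Sum.elim a b) F ≠ 0 ∧ eval (Sum.elim a b) G ≠ 0 := by
  have h1 : ∀ a b (H : MvPolynomial (σ ⊕ τ) ℂ),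
      eval a (aeval (Sum.elim MvPolynomial.X fun j => C (b j)) H : MvPolynomial σ ℂ) =
        eval (Sum.elim a b) H := by
    intro a b H
    induction H using MvPolynomial.induction_on with
    | C c => simp
    | add p q hp hq => simp only [map_add, hp, hq]
    | mul_X p i hp => cases i <;> simp [-coe_aeval_eq_eval, -aeval_eq_bind₁, hp]
  have h2 : ∀ a b (H : MvPolynomial (σ ⊕ τ) ℂ),
      eval b (aeval (Sum.elim (fun i => C (a i)) MvPolynomial.X) H : MvPolynomial τ ℂ) =
        eval (Sum.elim a b) H := by
    intro a b H
    induction H using MvPolynomial.induction_on with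
    | C c => simp
    | add p q hp hq => simp only [map_add, hp, hq]
    | mul_X p i hp => cases i <;> simp [-coe_aeval_eq_eval, -aeval_eq_bind₁, hp]
  rw [← h1] at hF hG
  obtain ⟨a, ha, haF, haG⟩ := exists_eval_ne_zero_and hX hx hx' hF hG
  rw [h1, ← h2] at haF haG
  obtain ⟨b, hb, hbF, hbG⟩ := exists_eval_ne_zero_and hY hy hy' haF haG
  rw [h2] at hbF hbG
  exact ⟨a, ha, b, hb, hbF, hbG⟩

/-- A functional killing every `w k` is zero, so the `w k` span and contain a basis. -/
theorem exists_det_ne_zero {σ ι : Type*} [Fintype σ] [DecidableEq σ] (w : ι → σ → ℂ)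
    (hw : ∀ v : σ → ℂ, (∀ k, ∑ i, w k i * v i = 0) → v = 0) :
    ∃ e : σ → ι, (Matrix.of fun i => w (e i)).det ≠ 0 := by
  have hspan : Submodule.span ℂ (Set.range w) = ⊤ := by
    by_contra hne
    obtain ⟨φ, hφ, hle⟩ := Submodule.exists_le_ker_of_lt_top _ (lt_top_iff_ne_top.2 hne)
    refine hφ ((LinearMap.pi_ext' fun i => LinearMap.ext_ring ?_))
    have hexp : ∀ u : σ → ℂ, φ u = ∑ i, u i * φ (Pi.single i 1) := fun u => by
      conv_lhs => rw [pi_eq_sum_univ' u]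
      simp [map_sum]
    have := congrFun (hw (fun i => φ (Pi.single i 1)) fun k => by
      rw [← hexp]
      exact hle (Submodule.subset_span ⟨k, rfl⟩)) i
    simpa using this
  obtain ⟨κ, a, -, ha, hli⟩ := exists_linearIndependent' ℂ w
  let b := Module.Basis.mk hli (by rw [ha, hspan])
  let f : σ ≃ κ := (Pi.basisFun ℂ σ).indexEquiv b
  refine ⟨a ∘ f, ?_⟩
  have hli' : LinearIndependent ℂ (Matrix.of fun i => w ((a ∘ f) i)).row :=
    hli.comp f f.injective
  rw [Matrix.linearIndependent_rows_iff_isUnit, Matrix.isUnit_iff_isUnit_det] at hli'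
  exact hli'.ne_zero

/-- Near a pair of points with transverse tangent spaces, transversality is witnessed by the
non-vanishing of a polynomial. -/
theorem exists_polynomial_forall_disjoint_tangentSpaceAt {σ : Type*} [Fintype σ]
    {X : Set (σ → ℂ)} {x y : σ → ℂ} (h : Disjoint (tangentSpaceAt X x) (tangentSpaceAt X y)) :
    ∃ D : MvPolynomial (σ ⊕ σ) ℂ, eval (Sum.elim x y) D ≠ 0 ∧ ∀ z, eval z D ≠ 0 →
      Disjoint (tangentSpaceAt X (z ∘ Sum.inl)) (tangentSpaceAt X (z ∘ Sum.inr)) := by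
  classical
  let N : vanishingIdeal ℂ X ⊕ vanishingIdeal ℂ X → σ → MvPolynomial (σ ⊕ σ) ℂ :=
    Sum.elim (fun f i => rename Sum.inl (pderiv i f.1)) fun f i => rename Sum.inr (pderiv i f.1)
  have hN : ∀ z v, (∀ k, ∑ i, eval z (N k i) * v i = 0) ↔
      v ∈ tangentSpaceAt X (z ∘ Sum.inl) ∧ v ∈ tangentSpaceAt X (z ∘ Sum.inr) := by
    intro z v
    rw [Sum.forall]
    simp only [N, Sum.elim_inl, Sum.elim_inr, eval_rename, Subtype.forall]
    rfl
  obtain ⟨e, he⟩ := exists_det_ne_zero (fun k i => eval (Sum.elim x y) (N k i)) fun v hv => by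
    obtain ⟨hvx, hvy⟩ := (hN _ v).1 hv
    exact Submodule.disjoint_def.1 h v hvx hvy
  have hdet : ∀ z, eval z (Matrix.of fun i => N (e i)).det =
      (Matrix.of fun i j => eval z (N (e i) j)).det := fun z => by
    rw [RingHom.map_det]
    rfl
  refine ⟨(Matrix.of fun i => N (e i)).det, by rw [hdet]; exact he, fun z hz => ?_⟩
  rw [hdet] at hz
  refine Submodule.disjoint_def.2 fun v hvx hvy => ?_
  refine Matrix.eq_zero_of_mulVec_eq_zero hz (funext fun i => ?_)
  exact (hN z v).2 ⟨hvx, hvy⟩ (e i)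

theorem mainTheorem7 (n : ℕ) (X : Set (Fin (2 * n) → ℂ)) (hX : IsSmoothAlgebraicSet n X)
    (h : InVeryGeneralPosition X ∨ InAffineVeryGeneralPosition X) :
    InGeneralPosition X ∧
      (IsIrreducibleSet X →
        HoldsGenerically (affineProd X X)
          (fun z => IsCompl (tangentSpaceAt X (z ∘ Sum.inl)) (tangentSpaceAt X (z ∘ Sum.inr)))) := by
  have hgen := inGeneralPosition_of_inVeryGeneralPosition hX h
  refine ⟨hgen, fun hirr => ?_⟩
  obtain ⟨x, hx, y, hy, hxy⟩ := hgen
  obtain ⟨D, hD, hDz⟩ := exists_polynomial_forall_disjoint_tangentSpaceAt hxy.disjoint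
  have hW : ∀ z, z ∈ zeroLocus ℂ (Ideal.span {D}) ↔ eval z D = 0 := fun z => by
    rw [zeroLocus_span]
    simp [aeval_eq_eval]
  refine ⟨zeroLocus ℂ (Ideal.span {D}), ⟨_, rfl⟩, fun z hz F hF => ?_, fun z hz => ?_⟩
  · by_contra hFz
    have hz' : eval (Sum.elim (z ∘ Sum.inl) (z ∘ Sum.inr)) F ≠ 0 := by
      rwa [Sum.elim_comp_inl_inr]
    -- Density: if `F` is nonzero at `z`, then `F` and `D` are both nonzero somewhere on `X × X`,
    -- but `F` vanishes wherever `D` does not.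
    obtain ⟨a, ha, b, hb, hFab, hDab⟩ :=
      exists_eval_sumElim_ne_zero_and hirr hirr hz.1 hx hz.2 hy hz' hD
    exact hFab (hF _ ⟨⟨ha, hb⟩, fun hmem => hDab ((hW _).1 hmem)⟩)
  · exact isCompl_tangentSpaceAt hX hz.1.1 hz.1.2 (hDz z fun h0 => hz.2 ((hW z).2 h0))

end
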